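/- Let $(a_k)_{k\ge 0}$ be the Stirling coefficients, i.e. the real sequence determined by the asymptotic expansion $$n!\sim n^n e^{-n}\sqrt{2\pi n}\,\sum_{k\ge 0}\frac{a_k}{n^k}\qquad(n\to\infty),$$ meaning that for every integer $N\ge 0$ $$n!-n^n e^{-n}\sqrt{2\pi n}\,\sum_{k=0}^{N}\frac{a_k}{n^k}=o\!\left(\frac{n^n e^{-n}\sqrt{2\pi n}}{n^N}\right)\qquad(n\to\infty).$$ Such a sequence exists, and for every integer $k\ge 0$ it is given by the explicit formula, involving only the four basic operations, $$a_k=\frac{(2k)!}{2^k\,k!}\sum_{i=0}^{2k}\binom{k+i-1/2}{i}\binom{3k+1/2}{2k-i}2^i\sum_{j=0}^{i}\binom{i}{j}\frac{(-1)^j}{(2k+i+j)!}\sum_{l=0}^{j}(-1)^l\binom{j}{l}(j-l)^{2k+i+j}.$$ Here $\binom{x}{m}=\frac{x(x-1)\cdots(x-m+1)}{m!}$ for real $x$ and integers $m\ge 0$, and $0^0=1$. -/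

import Mathlib

open scoped Nat Asymptotics

/-- `a` is the sequence of Stirling coefficients: the factorial has the (Poincaré) asymptotic
expansion `n! ∼ n ^ n * exp (-n) * √(2 π n) * ∑_{k ≥ 0} a k / n ^ k` as `n → ∞`, that is, for
every `N` the error committed by stopping after the term `k = N` is of smaller order than
`n ^ n * exp (-n) * √(2 π n) / n ^ N`. -/
def IsStirlingCoefficients (a : ℕ → ℝ) : Prop :=
  ∀ N : ℕ,
    (fun n : ℕ => (n ! : ℝ) -
        (n : ℝ) ^ n * Real.exp (-(n : ℝ)) * √(2 * Real.pi * n) *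
          ∑ k ∈ Finset.range (N + 1), a k / (n : ℝ) ^ k)
      =o[Filter.atTop]
    (fun n : ℕ => (n : ℝ) ^ n * Real.exp (-(n : ℝ)) * √(2 * Real.pi * n) / (n : ℝ) ^ N)

open Finset PowerSeries MeasureTheory

/-! Laplace's method. Substituting `t = n * exp (ε y)`, `ε = 1 / √n`, in Euler's integral gives `n!
= n ^ n * exp (-n) * √n * ∫ laplaceIntegrand ε`. The exponent is `-(y ^ 2 / 2) * F (ε y)`, where `F`
is the sum of `expTailSeries` and has constant term 1. Expanding in `F - 1` and in powers of `ε`,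
then integrating against the Gaussian, kills the odd powers and leaves `stirlingCoefficient k` at `ε
^ (2 k)`. The error is dominated by an integrable function
(`exists_integrable_abs_laplaceIntegrand_sub_le`).

The explicit formula is algebra: `stirlingCoefficient k` is `gaussianMoment k` times the coefficient
of `x ^ (2 k)` in `F ^ (-(k + 1 / 2))`. The binomial series is re-expanded in powers of `F`, and
these in powers of `exp x - 1`. An asymptotic expansion determines its coefficients, so this formula
holds for every admissible sequence. -/

/-- The Gaussian moment `(2 p - 1)‼ = (2 p)! / (2 ^ p p!)`. -/
noncomputable def gaussianMoment (p : ℕ) : ℝ := (2 * p)! / (2 ^ p * p !)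

theorem gaussianMoment_succ (p : ℕ) :
    gaussianMoment (p + 1) = (2 * p + 1) * gaussianMoment p := by
  have h : ((2 * (p + 1))! : ℝ) = (2 * p + 2) * ((2 * p + 1) * (2 * p)!) := by
    rw [show 2 * (p + 1) = 2 * p + 1 + 1 by ring, Nat.factorial_succ, Nat.factorial_succ]
    push_cast
    ring
  have hp : ((p + 1)! : ℝ) = (p + 1) * p ! := by rw [Nat.factorial_succ]; push_cast; ring
  have : (p ! : ℝ) ≠ 0 := by positivity
  have : (p : ℝ) + 1 ≠ 0 := by positivity
  rw [gaussianMoment, gaussianMoment, h, hp, pow_succ]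
  field_simp

/-- The power series of `2 (exp x - 1 - x) / x ^ 2`. -/
noncomputable def expTailSeries : ℝ⟦X⟧ := mk fun m => 2 / ((m + 2)! : ℝ)

/-- The Stirling coefficients, in the form in which Laplace's method produces them. -/
noncomputable def stirlingCoefficient (k : ℕ) : ℝ :=
  ∑ i ∈ range (2 * k + 1), (-1) ^ i / (2 ^ i * (i ! : ℝ)) * gaussianMoment (k + i) *
    coeff (2 * k) ((expTailSeries - 1) ^ i)

/-! ### Algebra of the explicit formula -/

theorem choose_succ_mul (r : ℝ) (i : ℕ) :
    (i + 1) * Ring.choose r (i + 1) = Ring.choose r i * (r - i) := by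
  have := Ring.choose_smul_choose r (Nat.le_add_right i 1)
  simpa [nsmul_eq_mul, Ring.choose_one_right] using this

theorem choose_neg_eq (r : ℝ) (n : ℕ) :
    Ring.choose (-r) n = (-1) ^ n * Ring.choose (r + n - 1) n := by
  rw [Ring.choose_neg, Int.negOnePow_def, Units.smul_def]
  simp

theorem sum_range_neg_one_pow_mul_choose (r : ℝ) (n : ℕ) :
    ∑ t ∈ range (n + 1), (-1) ^ t * Ring.choose r t = (-1) ^ n * Ring.choose (r - 1) n := by
  induction n with
  | zero => simp
  | succ n ih =>
    have := Ring.choose_succ_succ (r - 1) n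
    rw [sub_add_cancel] at this
    rw [sum_range_succ, ih, this]
    ring

/-- After expanding `(F - 1) ^ i`, trinomial revision extracts `Ring.choose r s`. What remains is a
partial alternating sum of binomials of `r - s`, which telescopes; upper negation removes its sign.
-/
theorem sum_choose_mul_sub_one_pow {A : Type*} [CommRing A] [Algebra ℝ A] (F : A) (r : ℝ)
    (n : ℕ) :
    ∑ i ∈ range (n + 1), Ring.choose r i • (F - 1) ^ i =
      ∑ s ∈ range (n + 1), (Ring.choose r s * Ring.choose (n - r) (n - s)) • F ^ s := by
  have h1 : ∀ i ∈ range (n + 1), Ring.choose r i • (F - 1) ^ i =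
      ∑ s ∈ range (n + 1), (Ring.choose r i * ((-1) ^ (i - s) * (i.choose s : ℝ))) • F ^ s := by
    intro i hi
    rw [sub_eq_add_neg, add_pow, smul_sum]
    have hsub : range (i + 1) ⊆ range (n + 1) := by
      intro x; simp at hi ⊢; omega
    rw [← sum_subset hsub]
    · refine sum_congr rfl fun s _ => ?_
      simp only [Algebra.smul_def, map_mul, map_pow, map_neg, map_one, map_natCast]
      ring
    · intro s _ hs
      rw [Nat.choose_eq_zero_of_lt (by simpa using hs)]
      simp
  rw [sum_congr rfl h1, sum_comm]
  refine sum_congr rfl fun s hs => ?_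
  rw [← sum_smul]
  congr 1
  have hsn : s ≤ n := by simp at hs; omega
  have h2 : ∑ i ∈ range (n + 1), Ring.choose r i * ((-1) ^ (i - s) * (i.choose s : ℝ)) =
      ∑ t ∈ range (n - s + 1), Ring.choose r s * ((-1) ^ t * Ring.choose (r - s) t) := by
    have : n + 1 = s + (n - s + 1) := by omega
    rw [this, sum_range_add, sum_eq_zero, zero_add]
    · refine sum_congr rfl fun t _ => ?_
      have := Ring.choose_smul_choose r (Nat.le_add_right s t)
      rw [nsmul_eq_mul, Nat.add_sub_cancel_left] at this
      rw [Nat.add_sub_cancel_left]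
      linear_combination (-1) ^ t * this
    · intro i hi
      rw [Nat.choose_eq_zero_of_lt (by simpa using hi)]
      simp
  rw [h2, ← mul_sum, sum_range_neg_one_pow_mul_choose,
    show (n : ℝ) - r = -(r - n) by ring, choose_neg_eq, Nat.cast_sub hsn]
  congr 3
  ring

/-- Identifies the Laplace weights with the coefficients of the binomial series of exponent `-(k + 1
/ 2)`. -/
theorem gaussianMoment_add (k i : ℕ) :
    (-1) ^ i / (2 ^ i * (i ! : ℝ)) * gaussianMoment (k + i) =
      gaussianMoment k * Ring.choose (-(k + 1 / 2 : ℝ)) i := by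
  induction i with
  | zero => simp
  | succ i ih =>
    have h := choose_succ_mul (-(k + 1 / 2 : ℝ)) i
    have hp : ((i + 1)! : ℝ) = (i + 1) * i ! := by rw [Nat.factorial_succ]; push_cast; ring
    have h0 : (i ! : ℝ) ≠ 0 := by positivity
    have h1 : (i : ℝ) + 1 ≠ 0 := by positivity
    apply mul_left_cancel₀ h1
    rw [mul_left_comm _ (gaussianMoment k), h, ← mul_assoc (gaussianMoment k), ← ih, ← add_assoc,
      gaussianMoment_succ, hp]
    push_cast
    field_simp
    ring

theorem coeff_exp_sub_one_pow (j n : ℕ) :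
    coeff n ((exp ℝ - 1) ^ j) =
      (∑ l ∈ range (j + 1), (-1) ^ l * (j.choose l : ℝ) * ((j : ℝ) - l) ^ n) / n ! := by
  rw [sub_eq_neg_add, add_pow, map_sum, sum_div]
  refine sum_congr rfl fun l hl => ?_
  have hl : l ≤ j := by simp at hl; omega
  rw [exp_pow_eq_rescale_exp, show (-1 : ℝ⟦X⟧) ^ l * rescale ((j - l : ℕ) : ℝ) (exp ℝ) *
    (j.choose l : ℝ⟦X⟧) = C ((-1) ^ l * (j.choose l : ℝ)) * rescale ((j - l : ℕ) : ℝ) (exp ℝ) by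
      simp only [map_mul, map_pow, map_neg, map_one, map_natCast]; ring,
    coeff_C_mul, coeff_rescale, coeff_exp, Nat.cast_sub hl]
  simp
  ring

/-- With `D = (exp x - 1) / x` one has `1 - D = -(x / 2) * expTailSeries`; the binomial theorem for
`(1 - D) ^ i` gives the identity. -/
theorem sum_choose_mul_coeff_exp_sub_one_pow (n i : ℕ) :
    ∑ j ∈ range (i + 1), (i.choose j : ℝ) * (-1) ^ j * coeff (n + i + j) ((exp ℝ - 1) ^ j) =
      (-1 / 2) ^ i * coeff n (expTailSeries ^ i) := by
  set D : ℝ⟦X⟧ := mk fun m => 1 / ((m + 1)! : ℝ) with hD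
  have h1 : exp ℝ - 1 = X * D := by
    ext m
    cases m with
    | zero => simp
    | succ m => simp [hD, coeff_succ_X_mul, coeff_exp, coeff_one]
  have h2 : -D + 1 = C (-1 / 2) * (X * expTailSeries) := by
    ext m
    cases m with
    | zero => simp [hD]
    | succ m =>
      simp [hD, coeff_succ_X_mul, coeff_one, expTailSeries]
      ring
  have h3 : ∀ j ∈ range (i + 1),
      (i.choose j : ℝ) * (-1) ^ j * coeff (n + i + j) ((exp ℝ - 1) ^ j) =
        coeff (n + i) ((-D) ^ j * 1 ^ (i - j) * (i.choose j : ℝ⟦X⟧)) := by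
    intro j _
    rw [h1, mul_pow, coeff_X_pow_mul, show (-D) ^ j * 1 ^ (i - j) * (i.choose j : ℝ⟦X⟧) =
      C ((i.choose j : ℝ) * (-1) ^ j) * D ^ j by
        rw [neg_pow]; simp only [map_mul, map_pow, map_neg, map_one, map_natCast, one_pow]; ring,
      coeff_C_mul]
  rw [sum_congr rfl h3, ← map_sum, ← add_pow, h2, mul_pow, mul_pow, ← map_pow, coeff_C_mul,
    coeff_X_pow_mul]

theorem stirlingCoefficient_eq (k : ℕ) :
    stirlingCoefficient k = ((2 * k)! : ℝ) / (2 ^ k * (k ! : ℝ)) *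
        ∑ i ∈ Finset.range (2 * k + 1),
          Ring.choose ((k : ℝ) + (i : ℝ) - 1 / 2) i *
          Ring.choose (3 * (k : ℝ) + 1 / 2) (2 * k - i) * 2 ^ i *
          ∑ j ∈ Finset.range (i + 1),
            (Nat.choose i j : ℝ) * ((-1) ^ j / ((2 * k + i + j)! : ℝ)) *
            ∑ l ∈ Finset.range (j + 1),
              (-1) ^ l * (Nat.choose j l : ℝ) * ((j : ℝ) - (l : ℝ)) ^ (2 * k + i + j) := by
  have h := congrArg (coeff (2 * k))
    (sum_choose_mul_sub_one_pow expTailSeries (-(k + 1 / 2 : ℝ)) (2 * k))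
  simp only [map_sum, map_smul, smul_eq_mul] at h
  simp only [stirlingCoefficient, gaussianMoment_add, mul_assoc, ← mul_sum]
  rw [h, ← gaussianMoment]
  congr 1
  refine sum_congr rfl fun i _ => ?_
  have h1 : ∀ j ∈ range (i + 1), (Nat.choose i j : ℝ) * ((-1) ^ j / ((2 * k + i + j)! : ℝ) *
      ∑ l ∈ Finset.range (j + 1),
        (-1) ^ l * ((Nat.choose j l : ℝ) * ((j : ℝ) - (l : ℝ)) ^ (2 * k + i + j))) =
      (i.choose j : ℝ) * (-1) ^ j * coeff (2 * k + i + j) ((exp ℝ - 1) ^ j) := by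
    intro j _
    rw [coeff_exp_sub_one_pow]
    simp only [mul_assoc]
    ring
  rw [sum_congr rfl h1, sum_choose_mul_coeff_exp_sub_one_pow, choose_neg_eq]
  have h2 : (2 : ℝ) ^ i * (-1 / 2) ^ i = (-1) ^ i := by rw [← mul_pow]; norm_num
  have e1 : (k : ℝ) + 1 / 2 + i - 1 = k + i - 1 / 2 := by ring
  have e2 : ((2 * k : ℕ) : ℝ) - -(k + 1 / 2) = 3 * k + 1 / 2 := by push_cast; ring
  rw [e1, e2, ← h2]
  ring

/-! ### Power series on the unit interval and the exponential tail -/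

/-- The power series `A` converges absolutely to `f` on the closed unit interval `|x| ≤ 1`. -/
def SumsTo (A : ℝ⟦X⟧) (f : ℝ → ℝ) : Prop :=
  Summable (fun m => ‖coeff m A‖) ∧ ∀ x, |x| ≤ 1 → HasSum (fun m => coeff m A * x ^ m) (f x)

theorem summable_norm_coeff_mul_pow {A : ℝ⟦X⟧} (hA : Summable fun m => ‖coeff m A‖) {x : ℝ}
    (hx : |x| ≤ 1) : Summable fun m => ‖coeff m A * x ^ m‖ := by
  refine hA.of_nonneg_of_le (fun _ => norm_nonneg _) fun m => ?_
  rw [norm_mul, norm_pow]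
  exact mul_le_of_le_one_right (norm_nonneg _) (pow_le_one₀ (norm_nonneg _) hx)

theorem SumsTo.mul {A B : ℝ⟦X⟧} {f g : ℝ → ℝ} (hA : SumsTo A f) (hB : SumsTo B g) :
    SumsTo (A * B) (fun x => f x * g x) := by
  have key : ∀ x m, ∑ kl ∈ antidiagonal m,
      (coeff kl.1 A * x ^ kl.1) * (coeff kl.2 B * x ^ kl.2) = coeff m (A * B) * x ^ m := by
    intro x m
    rw [coeff_mul, sum_mul]
    refine sum_congr rfl fun kl hkl => ?_
    rw [← mem_antidiagonal.mp hkl, pow_add]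
    ring
  refine ⟨?_, fun x hx => ?_⟩
  · simpa only [coeff_mul] using
      summable_norm_sum_mul_antidiagonal_of_summable_norm hA.1 hB.1
  · have sA := summable_norm_coeff_mul_pow hA.1 hx
    have sB := summable_norm_coeff_mul_pow hB.1 hx
    have s := summable_norm_sum_mul_antidiagonal_of_summable_norm sA sB
    have e := tsum_mul_tsum_eq_tsum_sum_antidiagonal_of_summable_norm sA sB
    simp only [key x] at s e
    rw [(hA.2 x hx).tsum_eq, (hB.2 x hx).tsum_eq] at e
    show HasSum _ (f x * g x)
    rw [e]
    exact s.of_norm.hasSum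

theorem SumsTo.one : SumsTo 1 (fun _ => 1) := by
  refine ⟨?_, fun x _ => ?_⟩
  · refine summable_of_ne_finset_zero (s := {0}) fun m hm => ?_
    simp at hm
    simp [coeff_one, hm]
  · convert hasSum_ite_eq 0 (1 : ℝ) using 2 with m
    by_cases hm : m = 0 <;> simp [coeff_one, hm]

theorem SumsTo.pow {A : ℝ⟦X⟧} {f : ℝ → ℝ} (hA : SumsTo A f) (i : ℕ) :
    SumsTo (A ^ i) (fun x => f x ^ i) := by
  induction i with
  | zero => simpa using SumsTo.one
  | succ i ih => simpa only [pow_succ] using ih.mul hA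

theorem SumsTo.exists_abs_sub_sum_le {A : ℝ⟦X⟧} {f : ℝ → ℝ} (hA : SumsTo A f) (D : ℕ) :
    ∃ C, 0 ≤ C ∧ ∀ x, |x| ≤ 1 →
      |f x - ∑ m ∈ range D, coeff m A * x ^ m| ≤ C * |x| ^ D := by
  refine ⟨∑' m, ‖coeff (m + D) A‖, tsum_nonneg fun _ => norm_nonneg _, fun x hx => ?_⟩
  have hs := summable_norm_coeff_mul_pow hA.1 hx
  have h := hs.of_norm.sum_add_tsum_nat_add D
  rw [(hA.2 x hx).tsum_eq] at h
  rw [← h, add_sub_cancel_left, ← tsum_mul_right]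
  have hs' := (summable_nat_add_iff D).2 hA.1
  refine (Real.norm_eq_abs _).symm.trans_le <| tsum_of_norm_bounded ((hs'.mul_right (|x| ^ D)).hasSum) fun m => ?_
  rw [norm_mul, norm_pow, pow_add]
  gcongr
  exact mul_le_of_le_one_left (by positivity) (pow_le_one₀ (norm_nonneg _) hx)

theorem coeff_expTailSeries_sub_one (m : ℕ) :
    coeff m (expTailSeries - 1) = if m = 0 then 0 else 2 / ((m + 2)! : ℝ) := by
  cases m <;> simp [expTailSeries, coeff_one]

/-- The function `2 (exp x - 1 - x - x ^ 2 / 2) / x ^ 2`, for `|x| ≤ 1`. -/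
noncomputable def expTail (x : ℝ) : ℝ := ∑' m, coeff m (expTailSeries - 1) * x ^ m

theorem sumsTo_expTail : SumsTo (expTailSeries - 1) expTail := by
  have h : Summable fun m => ‖coeff m (expTailSeries - 1)‖ := by
    refine ((Real.summable_pow_div_factorial 1).mul_left 2).of_nonneg_of_le
      (fun _ => norm_nonneg _) fun m => ?_
    rw [coeff_expTailSeries_sub_one]
    split_ifs
    · simp
    · rw [Real.norm_of_nonneg (by positivity), one_pow, mul_one_div]
      gcongr
      omega
  exact ⟨h, fun x hx => (summable_norm_coeff_mul_pow h hx).of_norm.hasSum⟩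

theorem exp_sub_one_sub_eq {x : ℝ} (hx : |x| ≤ 1) :
    Real.exp x - 1 - x = x ^ 2 / 2 * (1 + expTail x) := by
  have h2 := (Real.summable_pow_div_factorial x).sum_add_tsum_nat_add 3
  have he : Real.exp x = ∑' n, x ^ n / (n ! : ℝ) := by
    rw [Real.exp_eq_exp_ℝ, NormedSpace.exp_eq_tsum_div]
  have h3 := ((sumsTo_expTail.2 x hx).summable).sum_add_tsum_nat_add 1
  have h4 : ∑' m, x ^ (m + 3) / ((m + 3)! : ℝ) =
      x ^ 2 / 2 * ∑' m, coeff (m + 1) (expTailSeries - 1) * x ^ (m + 1) := by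
    rw [← tsum_mul_left]
    refine tsum_congr fun m => ?_
    rw [coeff_expTailSeries_sub_one, if_neg (by omega)]
    ring
  rw [h4] at h2
  simp only [sum_range_one, coeff_expTailSeries_sub_one 0, if_true, zero_mul, zero_add] at h3
  rw [h3, ← he] at h2
  rw [← expTail] at h2
  norm_num [sum_range_succ] at h2
  linarith

/-- The coefficients are nonnegative with zero constant term, so `|expTail x| ≤ expTail 1 * |x|`,
and `expTail 1 = 2 e - 5 < 1 / 2`. -/
theorem abs_expTail_le {x : ℝ} (hx : |x| ≤ 1) : |expTail x| ≤ |x| / 2 := by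
  have h1 := exp_sub_one_sub_eq (x := 1) (by simp)
  have h2 := Real.exp_one_lt_d9
  have h3 : expTail 1 ≤ 1 / 2 := by linarith
  have h4 : |expTail x| ≤ expTail 1 * |x| := by
    refine (Real.norm_eq_abs _).symm.trans_le <| tsum_of_norm_bounded ((sumsTo_expTail.2 1 (by simp)).mul_right |x|) fun m => ?_
    rw [coeff_expTailSeries_sub_one]
    split_ifs with hm
    · simp
    · rw [norm_mul, norm_pow, Real.norm_of_nonneg (by positivity), one_pow, mul_one]
      gcongr
      exact pow_le_of_le_one (abs_nonneg _) hx hm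
  nlinarith [abs_nonneg x]

theorem abs_div_four_le_exp_sub_one_sub {x : ℝ} (hx : 1 ≤ |x|) :
    |x| / 4 ≤ Real.exp x - 1 - x := by
  rcases le_or_gt 0 x with h | h
  · rw [abs_of_nonneg h] at hx ⊢
    nlinarith [Real.quadratic_le_exp_of_nonneg h]
  · rw [abs_of_neg h] at hx ⊢
    -- For `-2 ≤ x` the bound `1 + x / 2 ≤ exp (x / 2)` has nonnegative sides and may be squared,
    -- giving `x ^ 2 / 4`. Below `-2`, `exp x > 0` suffices.
    rcases le_or_gt (-2) x with h2 | h2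
    · have h3 : Real.exp x = Real.exp (x / 2) ^ 2 := by
        rw [← Real.exp_nat_mul]
        congr 1
        push_cast
        ring
      have h4 := Real.add_one_le_exp (x / 2)
      nlinarith [Real.exp_pos (x / 2)]
    · linarith [Real.exp_pos x]

theorem coeff_expTailSeries_sub_one_pow_eq_zero {i m : ℕ} (h : m < i) :
    coeff m ((expTailSeries - 1) ^ i) = 0 := by
  have : expTailSeries - 1 = X * PowerSeries.mk fun m => 2 / ((m + 3)! : ℝ) := by
    ext m
    rw [coeff_expTailSeries_sub_one]
    cases m with
    | zero => simp
    | succ m => simp [coeff_succ_X_mul]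
  rw [this, mul_pow, coeff_X_pow_mul', if_neg (by omega)]

/-! ### Integrable bounds for the truncated Laplace expansion -/

/-- The Laplace integrand `exp (-(exp x - 1 - x) / ε ^ 2)` at the rescaled point `x = ε y`. -/
noncomputable def laplaceIntegrand (ε y : ℝ) : ℝ :=
  Real.exp (-((Real.exp (ε * y) - 1 - ε * y) / ε ^ 2))

/-- The truncated expansion of `laplaceIntegrand ε y * exp (y ^ 2 / 2)` in powers of `ε`. -/
noncomputable def laplacePolynomial (D : ℕ) (ε y : ℝ) : ℝ :=
  ∑ i ∈ range D, (-(y ^ 2 / 2)) ^ i / (i ! : ℝ) *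
    ∑ m ∈ range D, coeff m ((expTailSeries - 1) ^ i) * (ε * y) ^ m

theorem abs_exp_sub_sum_le (z : ℝ) (D : ℕ) :
    |Real.exp z - ∑ i ∈ range D, z ^ i / (i ! : ℝ)| ≤ |z| ^ D * Real.exp |z| := by
  have h := Complex.norm_exp_sub_sum_le_norm_mul_exp z D
  have e : Complex.exp z - ∑ i ∈ range D, (z : ℂ) ^ i / (i ! : ℂ) =
      ((Real.exp z - ∑ i ∈ range D, z ^ i / (i ! : ℝ) : ℝ) : ℂ) := by
    push_cast
    rfl
  rwa [e, Complex.norm_real, Complex.norm_real] at h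

theorem integrable_pow_mul_exp_neg_mul_sq (p : ℕ) {b : ℝ} (hb : 0 < b) :
    Integrable fun y : ℝ => y ^ p * Real.exp (-b * y ^ 2) := by
  have := integrable_rpow_mul_exp_neg_mul_sq hb (s := p)
    (by have : (0 : ℝ) ≤ p := p.cast_nonneg
        linarith)
  simpa only [Real.rpow_natCast] using this

theorem integrable_abs_pow_mul_exp_neg_mul_sq (p : ℕ) {b : ℝ} (hb : 0 < b) :
    Integrable fun y : ℝ => |y| ^ p * Real.exp (-b * y ^ 2) := by
  refine (integrable_pow_mul_exp_neg_mul_sq p hb).norm.congr (.of_forall fun y => ?_)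
  simp

theorem integrable_abs_pow_mul_exp_neg_abs_div_four (p : ℕ) :
    Integrable fun y : ℝ => |y| ^ p * Real.exp (-(|y| / 4)) := by
  -- The constant comes from `|y| ^ q ≤ 4 ^ q * q! * exp (|y| / 4)` at `q = p` and `q = p + 2`,
  -- added to bound `|y| ^ p * (1 + y ^ 2)`.
  refine (integrable_inv_one_add_sq.const_mul
    (4 ^ p * (p ! : ℝ) + 4 ^ (p + 2) * ((p + 2)! : ℝ))).mono'
    (by fun_prop) (.of_forall fun y => ?_)
  have key : ∀ q : ℕ, |y| ^ q ≤ 4 ^ q * (q ! : ℝ) * Real.exp (|y| / 4) := by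
    intro q
    have h := Real.pow_div_factorial_le_exp (|y| / 4) (by positivity) q
    rw [div_pow, div_div, div_le_iff₀ (by positivity)] at h
    linarith
  have h1 := key p
  have h2 := key (p + 2)
  rw [Real.norm_of_nonneg (by positivity), Real.exp_neg, ← div_eq_mul_inv, ← div_eq_mul_inv,
    div_le_div_iff₀ (by positivity) (by positivity)]
  have h3 : |y| ^ (p + 2) = |y| ^ p * y ^ 2 := by rw [pow_add, sq_abs]
  linarith

theorem exists_abs_laplaceIntegrand_sub_le_of_abs_le (D : ℕ) :
    ∃ H : ℝ → ℝ, Integrable H ∧ (∀ y, 0 ≤ H y) ∧ ∀ ε y : ℝ, 0 < ε → |ε * y| ≤ 1 →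
      |laplaceIntegrand ε y - Real.exp (-(1 / 2) * y ^ 2) * laplacePolynomial D ε y| ≤
        ε ^ D * H y := by
  choose C hC hCx using fun i => (sumsTo_expTail.pow i).exists_abs_sub_sum_le D
  refine ⟨fun y => (1 / 4) ^ D * (|y| ^ (3 * D) * Real.exp (-(1 / 4) * y ^ 2)) +
    ∑ i ∈ range D, C i / (2 ^ i * (i ! : ℝ)) *
      (|y| ^ (2 * i + D) * Real.exp (-(1 / 2) * y ^ 2)), ?_, ?_, ?_⟩
  · refine .add (.const_mul (integrable_abs_pow_mul_exp_neg_mul_sq _ (by norm_num)) _)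
      (integrable_finsetSum _ fun i _ =>
        .const_mul (integrable_abs_pow_mul_exp_neg_mul_sq _ (by norm_num)) _)
  · intro y
    exact add_nonneg (by positivity) (sum_nonneg fun i _ =>
      mul_nonneg (div_nonneg (hC i) (by positivity)) (by positivity))
  · intro ε y hε hx
    set h := expTail (ε * y)
    set z := -(y ^ 2 / 2) * h with hz
    have hΦ : laplaceIntegrand ε y = Real.exp (-(1 / 2) * y ^ 2) * Real.exp z := by
      rw [laplaceIntegrand, exp_sub_one_sub_eq hx, ← Real.exp_add]
      congr 1
      rw [hz]
      field_simp
      ring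
    have hεy : |ε * y| = ε * |y| := by rw [abs_mul, abs_of_pos hε]
    have hhle : |h| ≤ ε * |y| / 2 := hεy ▸ abs_expTail_le hx
    have hzabs : |z| = y ^ 2 / 2 * |h| := by
      rw [hz, abs_mul, abs_neg, abs_of_nonneg (by positivity)]
    -- Each factor `z` carries an `ε`, so the exponential remainder yields `ε ^ D`.
    have hz1 : |z| ≤ 1 / 4 * ε * |y| ^ 3 := by
      rw [hzabs, ← sq_abs]
      nlinarith [mul_le_mul_of_nonneg_left hhle (sq_nonneg |y|)]
    -- Only half of the Gaussian exponent is spent on `exp |z|`; `exp (-y ^ 2 / 4)` survives.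
    have hz2 : |z| ≤ 1 / 4 * y ^ 2 := by
      rw [hzabs]
      nlinarith [sq_nonneg y, hεy ▸ hx]
    have b1 : |Real.exp (-(1 / 2) * y ^ 2) *
        (Real.exp z - ∑ i ∈ range D, z ^ i / (i ! : ℝ))| ≤
        ε ^ D * ((1 / 4) ^ D * (|y| ^ (3 * D) * Real.exp (-(1 / 4) * y ^ 2))) := by
      rw [abs_mul, abs_of_pos (Real.exp_pos _)]
      calc _ ≤ Real.exp (-(1 / 2) * y ^ 2) *
            ((1 / 4 * ε * |y| ^ 3) ^ D * Real.exp (1 / 4 * y ^ 2)) := by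
            refine mul_le_mul_of_nonneg_left ((abs_exp_sub_sum_le z D).trans ?_)
              (Real.exp_pos _).le
            gcongr
        _ = _ := by
            rw [show -(1 / 4) * y ^ 2 = -(1 / 2) * y ^ 2 + 1 / 4 * y ^ 2 by ring, Real.exp_add]
            ring
    have b2 : |Real.exp (-(1 / 2) * y ^ 2) *
        (∑ i ∈ range D, z ^ i / (i ! : ℝ) - laplacePolynomial D ε y)| ≤
        ε ^ D * ∑ i ∈ range D, C i / (2 ^ i * (i ! : ℝ)) *
          (|y| ^ (2 * i + D) * Real.exp (-(1 / 2) * y ^ 2)) := by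
      rw [laplacePolynomial, ← sum_sub_distrib, mul_sum, mul_sum]
      refine (abs_sum_le_sum_abs _ _).trans (sum_le_sum fun i _ => ?_)
      rw [hz, mul_pow, mul_div_right_comm, ← mul_sub, abs_mul, abs_mul,
        abs_of_pos (Real.exp_pos _), abs_div, abs_pow, abs_neg,
        abs_of_nonneg (show (0 : ℝ) ≤ y ^ 2 / 2 by positivity),
        abs_of_nonneg (show (0 : ℝ) ≤ (i ! : ℝ) by positivity)]
      calc _ ≤ Real.exp (-(1 / 2) * y ^ 2) *
            ((y ^ 2 / 2) ^ i / (i ! : ℝ) * (C i * (ε * |y|) ^ D)) := by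
            have := hεy ▸ hCx i (ε * y) hx
            gcongr
        _ = _ := by
            rw [← sq_abs, div_pow]
            ring
    rw [hΦ, mul_add]
    refine le_trans (le_of_eq ?_) ((abs_add_le _ _).trans (add_le_add b1 b2))
    congr 1
    ring

theorem exists_abs_laplaceIntegrand_sub_le_of_le_abs (D : ℕ) :
    ∃ H : ℝ → ℝ, Integrable H ∧ (∀ y, 0 ≤ H y) ∧ ∀ ε y : ℝ, 0 < ε → ε ≤ 1 → 1 ≤ |ε * y| →
      |laplaceIntegrand ε y - Real.exp (-(1 / 2) * y ^ 2) * laplacePolynomial D ε y| ≤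
        ε ^ D * H y := by
  refine ⟨fun y => |y| ^ D * Real.exp (-(|y| / 4)) +
    ∑ i ∈ range D, ∑ m ∈ range D,
      |coeff m ((expTailSeries - 1) ^ i)| / (2 ^ i * (i ! : ℝ)) *
      (|y| ^ (2 * i + m + D) * Real.exp (-(1 / 2) * y ^ 2)), ?_, ?_, ?_⟩
  · refine .add (integrable_abs_pow_mul_exp_neg_abs_div_four D)
      (integrable_finsetSum _ fun i _ => integrable_finsetSum _ fun m _ =>
        .const_mul (integrable_abs_pow_mul_exp_neg_mul_sq _ (by norm_num)) _)
  · intro y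
    positivity
  · intro ε y hε hε1 hx
    have hεy : |ε * y| = ε * |y| := by rw [abs_mul, abs_of_pos hε]
    -- In this region `ε ^ D` can be gained at the cost of `|y| ^ D`, so integrand and polynomial
    -- are bounded separately, without cancellation.
    have hpow : 1 ≤ (ε * |y|) ^ D := one_le_pow₀ (hεy ▸ hx)
    have b1 : |laplaceIntegrand ε y| ≤ ε ^ D * (|y| ^ D * Real.exp (-(|y| / 4))) := by
      rw [laplaceIntegrand, abs_of_pos (Real.exp_pos _), ← mul_assoc, ← mul_pow]
      refine le_trans ?_ (le_mul_of_one_le_left (Real.exp_pos _).le hpow)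
      rw [Real.exp_le_exp, neg_le_neg_iff, le_div_iff₀ (by positivity)]
      refine le_trans ?_ (abs_div_four_le_exp_sub_one_sub hx)
      rw [hεy]
      nlinarith [mul_nonneg hε.le (abs_nonneg y)]
    have b2 : |Real.exp (-(1 / 2) * y ^ 2) * laplacePolynomial D ε y| ≤
        ε ^ D * ∑ i ∈ range D, ∑ m ∈ range D,
          |coeff m ((expTailSeries - 1) ^ i)| / (2 ^ i * (i ! : ℝ)) *
          (|y| ^ (2 * i + m + D) * Real.exp (-(1 / 2) * y ^ 2)) := by
      simp only [laplacePolynomial, mul_sum]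
      refine (abs_sum_le_sum_abs _ _).trans (sum_le_sum fun i _ => ?_)
      refine (abs_sum_le_sum_abs _ _).trans (sum_le_sum fun m _ => ?_)
      rw [abs_mul, abs_mul, abs_mul, abs_of_pos (Real.exp_pos _), abs_div, abs_pow, abs_neg,
        abs_pow, abs_of_nonneg (show (0 : ℝ) ≤ y ^ 2 / 2 by positivity),
        abs_of_nonneg (show (0 : ℝ) ≤ (i ! : ℝ) by positivity), hεy]
      calc _ ≤ Real.exp (-(1 / 2) * y ^ 2) * ((y ^ 2 / 2) ^ i / (i ! : ℝ) *
            (|coeff m ((expTailSeries - 1) ^ i)| * (1 * |y|) ^ m)) * (ε * |y|) ^ D := by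
            refine le_trans ?_ (le_mul_of_one_le_right (by positivity) hpow)
            gcongr
        _ = _ := by
            rw [← sq_abs, div_pow]
            ring
    rw [mul_add]
    exact (abs_sub _ _).trans (add_le_add b1 b2)

theorem exists_integrable_abs_laplaceIntegrand_sub_le (D : ℕ) :
    ∃ H : ℝ → ℝ, Integrable H ∧ ∀ ε y : ℝ, 0 < ε → ε ≤ 1 →
      |laplaceIntegrand ε y - Real.exp (-(1 / 2) * y ^ 2) * laplacePolynomial D ε y| ≤
        ε ^ D * H y := by
  obtain ⟨H₁, i₁, n₁, h₁⟩ := exists_abs_laplaceIntegrand_sub_le_of_abs_le D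
  obtain ⟨H₂, i₂, n₂, h₂⟩ := exists_abs_laplaceIntegrand_sub_le_of_le_abs D
  refine ⟨fun y => H₁ y + H₂ y, i₁.add i₂, fun ε y hε hε1 => ?_⟩
  rcases le_total |ε * y| 1 with hx | hx
  · refine (h₁ ε y hε hx).trans ?_
    gcongr
    linarith [n₂ y]
  · refine (h₂ ε y hε hε1 hx).trans ?_
    gcongr
    linarith [n₁ y]

/-! ### Gaussian integrals and the expansion of the Laplace integral -/

theorem gaussianMoment_mul_sqrt_pi (q : ℕ) :
    2 ^ q * √2 * Real.Gamma (q + 1 / 2) = √(2 * Real.pi) * gaussianMoment q := by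
  induction q with
  | zero =>
    rw [Real.sqrt_mul (by norm_num)]
    simp [gaussianMoment, -one_div, Real.Gamma_one_half_eq]
  | succ q ih =>
    rw [gaussianMoment_succ, mul_left_comm, ← ih]
    push_cast
    rw [add_right_comm, Real.Gamma_add_one (by positivity)]
    ring

theorem integral_even_pow_mul_exp (q : ℕ) :
    ∫ y : ℝ, y ^ (2 * q) * Real.exp (-(1 / 2) * y ^ 2) = √(2 * Real.pi) * gaussianMoment q := by
  have h := integral_comp_abs (f := fun y : ℝ => y ^ (2 * q) * Real.exp (-(1 / 2) * y ^ 2))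
  simp only [sq_abs, pow_mul] at h
  simp only [pow_mul]
  rw [h]
  have h2 := integral_rpow_mul_exp_neg_mul_rpow (p := 2) (q := ((2 * q : ℕ) : ℝ)) (b := 1 / 2)
    (by norm_num) (by have : (0 : ℝ) ≤ (2 * q : ℕ) := Nat.cast_nonneg _
                      linarith) (by norm_num)
  simp only [Real.rpow_natCast, Real.rpow_two, pow_mul] at h2
  rw [h2, ← gaussianMoment_mul_sqrt_pi]
  have e1 : (((2 * q : ℕ) : ℝ) + 1) / 2 = q + 1 / 2 := by push_cast; ring
  have e2 : -(((2 * q : ℕ) : ℝ) + 1) / 2 = -(q + 1 / 2) := by push_cast; ring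
  rw [e1, e2, one_div, Real.inv_rpow (by norm_num), Real.rpow_neg (by norm_num), inv_inv,
    Real.rpow_add (by norm_num), Real.rpow_natCast, Real.sqrt_eq_rpow, one_div]
  ring

theorem integral_odd_pow_mul_exp (q : ℕ) :
    ∫ y : ℝ, y ^ (2 * q + 1) * Real.exp (-(1 / 2) * y ^ 2) = 0 := by
  have h := integral_neg_eq_self (fun y : ℝ => y ^ (2 * q + 1) * Real.exp (-(1 / 2) * y ^ 2))
    volume
  simp only [neg_sq, Odd.neg_pow ⟨q, rfl⟩, neg_mul, integral_neg] at h ⊢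
  linarith

theorem sum_range_two_mul_add_one_of_odd_eq_zero {M : Type*} [AddCommMonoid M] (f : ℕ → M)
    (hf : ∀ k, f (2 * k + 1) = 0) (N : ℕ) :
    ∑ m ∈ range (2 * N + 1), f m = ∑ k ∈ range (N + 1), f (2 * k) := by
  induction N with
  | zero => simp
  | succ N ih =>
    rw [sum_range_succ _ (N + 1), ← ih, show 2 * (N + 1) + 1 = 2 * N + 1 + 1 + 1 by ring,
      sum_range_succ, sum_range_succ, hf, add_zero]
    rfl

theorem exp_mul_laplacePolynomial (D : ℕ) (ε y : ℝ) :
    Real.exp (-(1 / 2) * y ^ 2) * laplacePolynomial D ε y =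
      ∑ m ∈ range D, ∑ i ∈ range D, (-1) ^ i / (2 ^ i * (i ! : ℝ)) *
        coeff m ((expTailSeries - 1) ^ i) * ε ^ m *
          (y ^ (m + 2 * i) * Real.exp (-(1 / 2) * y ^ 2)) := by
  rw [sum_comm]
  simp only [laplacePolynomial, mul_sum]
  refine sum_congr rfl fun i _ => sum_congr rfl fun m _ => ?_
  rw [neg_pow (y ^ 2 / 2), div_pow]
  ring

theorem integrable_exp_mul_laplacePolynomial (D : ℕ) (ε : ℝ) :
    Integrable fun y => Real.exp (-(1 / 2) * y ^ 2) * laplacePolynomial D ε y := by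
  simp only [exp_mul_laplacePolynomial]
  exact integrable_finsetSum _ fun m _ => integrable_finsetSum _ fun i _ =>
    (integrable_pow_mul_exp_neg_mul_sq _ (by norm_num)).const_mul _

theorem integral_exp_mul_laplacePolynomial (N : ℕ) (ε : ℝ) :
    ∫ y, Real.exp (-(1 / 2) * y ^ 2) * laplacePolynomial (2 * N + 1) ε y =
      √(2 * Real.pi) * ∑ k ∈ range (N + 1), stirlingCoefficient k * ε ^ (2 * k) := by
  have hint : ∀ m i : ℕ, Integrable fun y : ℝ => (-1) ^ i / (2 ^ i * (i ! : ℝ)) *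
      coeff m ((expTailSeries - 1) ^ i) * ε ^ m *
        (y ^ (m + 2 * i) * Real.exp (-(1 / 2) * y ^ 2)) := fun m i =>
    (integrable_pow_mul_exp_neg_mul_sq _ (by norm_num)).const_mul _
  simp only [exp_mul_laplacePolynomial]
  rw [integral_finsetSum _ fun m _ => integrable_finsetSum _ fun i _ => hint m i]
  simp only [integral_finsetSum _ fun i _ => hint _ i, integral_const_mul]
  rw [sum_range_two_mul_add_one_of_odd_eq_zero, mul_sum]
  · refine sum_congr rfl fun k hk => ?_
    have hsub : range (2 * k + 1) ⊆ range (2 * N + 1) := by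
      intro x; simp at hk ⊢; omega
    -- `(expTailSeries - 1) ^ i` is divisible by `X ^ i`, so terms with `i > 2 k` vanish.
    rw [← sum_subset hsub, stirlingCoefficient, sum_mul, mul_sum]
    · refine sum_congr rfl fun i _ => ?_
      rw [← mul_add 2 k i, integral_even_pow_mul_exp]
      ring
    · intro i _ hi
      rw [coeff_expTailSeries_sub_one_pow_eq_zero (by simp at hi; omega)]
      simp
  · intro k
    refine sum_eq_zero fun i _ => ?_
    rw [show 2 * k + 1 + 2 * i = 2 * (k + i) + 1 by ring, integral_odd_pow_mul_exp, mul_zero]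

/-- The cutoff `2 N + 1` leaves a spare factor `ε = 1 / √n` beyond `n ^ (-N)`, which later turns `O`
into `o`. -/
theorem exists_abs_integral_laplaceIntegrand_sub_le (N : ℕ) :
    ∃ K : ℝ, ∀ ε : ℝ, 0 < ε → ε ≤ 1 →
      |(∫ y, laplaceIntegrand ε y) -
        √(2 * Real.pi) * ∑ k ∈ range (N + 1), stirlingCoefficient k * ε ^ (2 * k)| ≤
        K * ε ^ (2 * N + 1) := by
  obtain ⟨H, hH, hb⟩ := exists_integrable_abs_laplaceIntegrand_sub_le (2 * N + 1)
  refine ⟨∫ y, H y, fun ε hε hε1 => ?_⟩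
  have hT := integrable_exp_mul_laplacePolynomial (2 * N + 1) ε
  have hcont : Continuous (laplaceIntegrand ε) := by
    unfold laplaceIntegrand
    fun_prop
  have hd : Integrable fun y => laplaceIntegrand ε y -
      Real.exp (-(1 / 2) * y ^ 2) * laplacePolynomial (2 * N + 1) ε y :=
    (hH.const_mul (ε ^ (2 * N + 1))).mono' (hcont.aestronglyMeasurable.sub hT.1)
      (.of_forall fun y => hb ε y hε hε1)
  have hΦ : Integrable (laplaceIntegrand ε) := by
    simpa only [Pi.add_def, sub_add_cancel] using hd.add hT
  rw [← integral_exp_mul_laplacePolynomial, ← integral_sub hΦ hT, mul_comm (∫ y, H y),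
    ← integral_const_mul]
  refine (Real.norm_eq_abs _).symm.trans_le <| norm_integral_le_of_norm_le
    (hH.const_mul (ε ^ (2 * N + 1))) (.of_forall fun y => hb ε y hε hε1)

/-! ### The asymptotic expansion of the factorial and its uniqueness -/

theorem factorial_eq_integral_laplaceIntegrand {n : ℕ} (hn : n ≠ 0) :
    (n ! : ℝ) = (n : ℝ) ^ n * Real.exp (-n) * √n * ∫ y, laplaceIntegrand (√n)⁻¹ y := by
  have hn0 : (0 : ℝ) < n := by positivity
  have hs : 0 < √(n : ℝ) := Real.sqrt_pos.2 hn0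
  have hsq : √(n : ℝ) ^ 2 = n := Real.sq_sqrt hn0.le
  set f : ℝ → ℝ := fun y => n * Real.exp ((√n)⁻¹ * y) with hf
  have himg : f '' Set.univ = Set.Ioi 0 := by
    ext t
    simp only [Set.mem_image, Set.mem_univ, true_and, Set.mem_Ioi, hf]
    constructor
    · rintro ⟨y, rfl⟩
      positivity
    · intro ht
      refine ⟨√n * Real.log (t / n), ?_⟩
      rw [inv_mul_cancel_left₀ hs.ne', Real.exp_log (by positivity)]
      field_simp
  have hderiv : ∀ y ∈ Set.univ,
      HasDerivWithinAt f (n * (Real.exp ((√n)⁻¹ * y) * ((√n)⁻¹ * 1))) Set.univ y :=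
    fun y _ => ((((hasDerivAt_id y).const_mul (√n)⁻¹).exp).const_mul (n : ℝ)).hasDerivWithinAt
  have hinj : Set.InjOn f Set.univ := by
    intro x _ y _ hxy
    have := Real.exp_injective (mul_left_cancel₀ hn0.ne' hxy)
    exact mul_left_cancel₀ (inv_ne_zero hs.ne') this
  -- Starting from `n * Γ(n)`, the substitution gives `dt / t = dy / √n`, so no stray exponential
  -- factor remains.
  have h := integral_image_eq_integral_abs_deriv_smul MeasurableSet.univ hderiv hinj
    (fun t => Real.exp (-t) * t ^ ((n : ℝ) - 1))
  rw [himg, ← Real.Gamma_eq_integral hn0, Measure.restrict_univ] at h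
  rw [← Real.Gamma_nat_eq_factorial, Real.Gamma_add_one hn0.ne', h, ← integral_const_mul,
    ← integral_const_mul]
  refine integral_congr_ae (.of_forall fun y => ?_)
  have hpos : 0 < f y := by positivity
  have hrpow : f y ^ ((n : ℝ) - 1) = f y ^ n / f y := by
    rw [Real.rpow_sub_one hpos.ne', Real.rpow_natCast]
  have hexp : laplaceIntegrand (√n)⁻¹ y =
      Real.exp (-(f y)) * Real.exp n * Real.exp ((√n)⁻¹ * y) ^ n := by
    rw [laplaceIntegrand, ← Real.exp_nat_mul, ← Real.exp_add, ← Real.exp_add, inv_pow, hsq,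
      div_inv_eq_mul]
    congr 1
    simp only [hf]
    ring
  have habs : |n * (Real.exp ((√n)⁻¹ * y) * ((√n)⁻¹ * 1))| = f y * (√n)⁻¹ := by
    rw [abs_of_nonneg (by positivity)]
    simp only [hf]
    ring
  have hee : Real.exp (-(n : ℝ)) * Real.exp n = 1 := by rw [← Real.exp_add]; simp
  have hsn : (n : ℝ) * (√n)⁻¹ = √n := by
    rw [← div_eq_mul_inv, Real.div_sqrt]
  have hfn : f y ^ n = (n : ℝ) ^ n * Real.exp ((√n)⁻¹ * y) ^ n := mul_pow _ _ _
  simp only [smul_eq_mul]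
  rw [habs, hrpow, hexp, hfn]
  calc _ = (n * (√n)⁻¹) * (f y / f y) * Real.exp (-f y) *
        ((n : ℝ) ^ n * Real.exp ((√n)⁻¹ * y) ^ n) := by ring
    _ = √n * (Real.exp (-(n : ℝ)) * Real.exp n) * Real.exp (-f y) *
        ((n : ℝ) ^ n * Real.exp ((√n)⁻¹ * y) ^ n) := by
        rw [hsn, div_self hpos.ne', hee]
    _ = _ := by ring

theorem isStirlingCoefficients_stirlingCoefficient :
    IsStirlingCoefficients stirlingCoefficient := by
  intro N
  obtain ⟨K, hK⟩ := exists_abs_integral_laplaceIntegrand_sub_le N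
  have hu : (fun n : ℕ => (∫ y, laplaceIntegrand (√n)⁻¹ y) - √(2 * Real.pi) *
      ∑ k ∈ range (N + 1), stirlingCoefficient k * (√n)⁻¹ ^ (2 * k)) =o[Filter.atTop]
      fun n : ℕ => √(2 * Real.pi) / (n : ℝ) ^ N := by
    have h1 : (fun n : ℕ => (∫ y, laplaceIntegrand (√n)⁻¹ y) - √(2 * Real.pi) *
        ∑ k ∈ range (N + 1), stirlingCoefficient k * (√n)⁻¹ ^ (2 * k)) =O[Filter.atTop]
        fun n : ℕ => √(2 * Real.pi) / (n : ℝ) ^ N * (√n)⁻¹ := by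
      refine .of_bound (K / √(2 * Real.pi)) ?_
      filter_upwards [Filter.eventually_ge_atTop 1] with n hn
      have hn1 : (1 : ℝ) ≤ n := by exact_mod_cast hn
      have hs : 1 ≤ √(n : ℝ) := Real.one_le_sqrt.2 hn1
      have h := hK (√n)⁻¹ (by positivity) (inv_le_one_of_one_le₀ hs)
      rw [Real.norm_eq_abs, Real.norm_of_nonneg (by positivity)]
      refine h.trans (le_of_eq ?_)
      have hp : √(2 * Real.pi) ≠ 0 := by positivity
      rw [pow_succ, pow_mul, inv_pow, Real.sq_sqrt (by positivity), inv_pow]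
      field_simp
    have h2 : (fun n : ℕ => (√(n : ℝ))⁻¹) =o[Filter.atTop] fun _ => (1 : ℝ) := by
      rw [Asymptotics.isLittleO_one_iff]
      exact (Real.tendsto_sqrt_atTop.comp tendsto_natCast_atTop_atTop).inv_tendsto_atTop
    refine h1.trans_isLittleO ?_
    simpa using (Asymptotics.isBigO_refl (fun n : ℕ => √(2 * Real.pi) / (n : ℝ) ^ N)
      Filter.atTop).mul_isLittleO h2
  have h := (Asymptotics.isBigO_refl (fun n : ℕ => (n : ℝ) ^ n * Real.exp (-(n : ℝ)) * √n)
      Filter.atTop).mul_isLittleO hu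
  refine h.congr' ?_ ?_
  · filter_upwards [Filter.eventually_ne_atTop 0] with n hn
    have hs : ∑ k ∈ range (N + 1), stirlingCoefficient k * (√n)⁻¹ ^ (2 * k) =
        ∑ k ∈ range (N + 1), stirlingCoefficient k / (n : ℝ) ^ k := by
      refine sum_congr rfl fun k _ => ?_
      rw [pow_mul, inv_pow, Real.sq_sqrt (by positivity), inv_pow, div_eq_mul_inv]
    rw [hs, mul_sub, ← factorial_eq_integral_laplaceIntegrand hn,
      Real.sqrt_mul (by positivity) (n : ℝ)]
    ring
  · refine .of_forall fun n => ?_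
    simp only
    rw [Real.sqrt_mul (by positivity) (n : ℝ)]
    ring

/-- Once the earlier coefficients agree, subtracting the two expansions at order `N` and rescaling
leaves the constant `a N - b N`, which is `o(1)`. -/
theorem IsStirlingCoefficients.unique {a b : ℕ → ℝ} (ha : IsStirlingCoefficients a)
    (hb : IsStirlingCoefficients b) (N : ℕ) : a N = b N := by
  induction N using Nat.strong_induction_on with
  | _ N ih =>
    have h := (hb N).sub (ha N)
    have h' : (fun _ : ℕ => a N - b N) =o[Filter.atTop] fun _ : ℕ => (1 : ℝ) := by
      have h2 := (Asymptotics.isBigO_refl (fun n : ℕ =>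
        ((n : ℝ) ^ n * Real.exp (-(n : ℝ)) * √(2 * Real.pi * n) / (n : ℝ) ^ N)⁻¹)
        Filter.atTop).mul_isLittleO h
      refine h2.congr' ?_ ?_
      · filter_upwards [Filter.eventually_ne_atTop 0] with n hn
        have hs : √(2 * Real.pi * (n : ℝ)) ≠ 0 := by positivity
        have hn0 : (n : ℝ) ≠ 0 := by positivity
        have he : ∑ k ∈ range N, a k / (n : ℝ) ^ k = ∑ k ∈ range N, b k / (n : ℝ) ^ k :=
          sum_congr rfl fun k hk => by rw [ih k (mem_range.1 hk)]
        rw [sum_range_succ, sum_range_succ, he]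
        field_simp
        ring
      · filter_upwards [Filter.eventually_ne_atTop 0] with n hn
        exact inv_mul_cancel₀ (by positivity)
    rw [Asymptotics.isLittleO_one_iff, tendsto_const_nhds_iff] at h'
    exact sub_eq_zero.1 h'

theorem mainTheorem2 :
    (∃ a : ℕ → ℝ, IsStirlingCoefficients a) ∧
    ∀ a : ℕ → ℝ, IsStirlingCoefficients a → ∀ k : ℕ,
      a k = ((2 * k)! : ℝ) / (2 ^ k * (k ! : ℝ)) *
        ∑ i ∈ Finset.range (2 * k + 1),
          Ring.choose ((k : ℝ) + (i : ℝ) - 1 / 2) i *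
          Ring.choose (3 * (k : ℝ) + 1 / 2) (2 * k - i) * 2 ^ i *
          ∑ j ∈ Finset.range (i + 1),
            (Nat.choose i j : ℝ) * ((-1) ^ j / ((2 * k + i + j)! : ℝ)) *
            ∑ l ∈ Finset.range (j + 1),
              (-1) ^ l * (Nat.choose j l : ℝ) * ((j : ℝ) - (l : ℝ)) ^ (2 * k + i + j) := by
  refine ⟨⟨_, isStirlingCoefficients_stirlingCoefficient⟩, fun a ha k => ?_⟩
  rw [ha.unique isStirlingCoefficients_stirlingCoefficient k, stirlingCoefficient_eq]
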